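/- Let $X$ be a compact smooth manifold with a Riemannian metric $g$ and an orientation, let $\mathcal A\to X$ be a locally trivial smooth bundle of finite-dimensional complex $C^*$-algebras, and let $\mathcal E\to X$ be a smooth complex Hermitian vector bundle of locally constant finite rank. Let $k\in\mathbb Z/8$ and let $(\varepsilon,\varepsilon',\varepsilon'')\in\{\pm1\}^3$ be the usual signs of $KO$-dimension $k$: $\varepsilon=+,+,-,-,-,-,+,+$ and $\varepsilon'=+,-,+,+,+,-,+,+$ for $k=0,\dots,7$, and $\varepsilon''=+,-,+,-$ for $k=0,2,4,6$. Suppose given: 1. a smooth Clifford action $c:T^*X\to\mathrm{End}(\mathcal E)$ by skew-adjoint endomorphisms with $c(\xi)^2=-g(\xi,\xi)$, extended to the complexified Clifford bundle $\mathbb{C}\mathrm{l}(X)$, and a smooth faithful (fibrewise injective) unital $*$-representation of $\mathcal A\otimes\mathcal A^{o}$ on $\mathcal E$ commuting with $c$, written $c(\omega\otimes a\otimes b^{o})$ together with the Clifford action; when $k$ is even, also a smooth self-adjoint $\gamma\in\mathrm{End}(\mathcal E)$ with $\gamma^2=1$ for which covectors act as odd and $\mathcal A\otimes\mathcal A^{o}$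 as even operators; 2. a smooth antiunitary bundle automorphism $J$ of $\mathcal E$ (covering the identity of $X$) with $J^2=\varepsilon$, with $J\,c(\omega^*\otimes a^*\otimes (b^*)^{o})\,J^*=c(\tau_{\varepsilon'}(\omega)\otimes b\otimes a^{o})$ for all $\omega\in C^\infty(X,\mathbb{C}\mathrm{l}(X))$ and $a,b\in C^\infty(X,\mathcal A)$, where $\tau_{\varepsilon'}$ is the $\mathbb C$-linear anti-involution with $\tau_{\varepsilon'}(\xi)=-\varepsilon'\xi$ on covectors, and with $J\gamma=\varepsilon''\gamma J$ when $k$ is even; 3. a symmetric Dirac-type operator $D$ on $\mathcal E$, that is, $[D,f]=c(df)$ for $f\in C^\infty(X)$, which is odd when $k$ is even, such that $DJ=\varepsilon' JD$ and $[[D,a],b^{o}]=0$ for all $a,b\in C^\infty(X,\mathcal A)$. (That is, $(C^\infty(X,\mathcal A),L^2(X,\mathcal E),D,J)$ is a concrete real almost-commutative spectral triple of $KO$-dimension $k \bmod 8$.) Let $C^\infty(X,\mathcal A)$ act on the Hilbert space $L^2(X,\mathcal E)$ through $a\mapsto a\otimes 1$, and regard $J$ as an antiunitary operator on $L^2(X,\mathcal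 E)$. Then $$\{a\in C^\infty(X,\mathcal A)\;:\;J a^* J^*=a\}\;=\;C^\infty(X)\,1_{\mathcal A},$$ where $C^\infty(X)$ denotes the complex-valued smooth functions on $X$. -/

import Mathlib

open Bundle Manifold MeasureTheory
open scoped ContDiff TensorProduct InnerProductSpace

universe u v w

noncomputable section
namespace RealAC

/-- A smooth Riemannian metric on the `n`-manifold `X`. -/
abbrev RiemMetric (n : ℕ) (X : Type u) [TopologicalSpace X]
    [ChartedSpace (EuclideanSpace ℝ (Fin n)) X] [IsManifold (𝓡 n) ∞ X] : Type u :=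
  ContMDiffRiemannianMetric (𝓡 n) ∞ (EuclideanSpace ℝ (Fin n))
    (fun x : X => TangentSpace (𝓡 n) x)

/-- An orientation of the `n`-manifold `X`, given by a smooth atlas with positive Jacobians. -/
structure OrientedAtlas (n : ℕ) (X : Type u) [TopologicalSpace X]
    [ChartedSpace (EuclideanSpace ℝ (Fin n)) X] where
  charts : Set (OpenPartialHomeomorph X (EuclideanSpace ℝ (Fin n)))
  smooth : charts ⊆ IsManifold.maximalAtlas (𝓡 n) ∞ X
  cover : ∀ x : X, ∃ e ∈ charts, x ∈ e.source
  jacobian_pos : ∀ e ∈ charts, ∀ e' ∈ charts, ∀ y ∈ (e.symm.trans e').source,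
    0 < (fderiv ℝ (e.symm.trans e') y).det

section Volume

variable {n : ℕ} {X : Type u} [TopologicalSpace X]
  [ChartedSpace (EuclideanSpace ℝ (Fin n)) X] [IsManifold (𝓡 n) ∞ X]

/-- The coordinate vector `∂ᵢ` at `x`, in the preferred chart around `x₀`. -/
def coordVector (x₀ x : X) (i : Fin n) : TangentSpace (𝓡 n) x :=
  (trivializationAt (EuclideanSpace ℝ (Fin n)) (fun x : X => TangentSpace (𝓡 n) x) x₀).symm x
    (EuclideanSpace.single i 1)

/-- The function `√ det (g (∂ᵢ, ∂ⱼ))` of the preferred chart around `x₀`. -/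
def volumeDensity (g : RiemMetric n X) (x₀ x : X) : ℝ :=
  √ (Matrix.of fun i j : Fin n => g.inner x (coordVector x₀ x i) (coordVector x₀ x j)).det

theorem continuousOn_volumeDensity (g : RiemMetric n X) (x₀ : X) :
    ContinuousOn (volumeDensity g x₀) (chartAt (EuclideanSpace ℝ (Fin n)) x₀).source := by
  have hsec : ∀ i : Fin n, ContMDiffOn (𝓡 n) ((𝓡 n).prod 𝓘(ℝ, EuclideanSpace ℝ (Fin n))) ∞
      (fun x : X => (TotalSpace.mk' (EuclideanSpace ℝ (Fin n)) x (coordVector x₀ x i) :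
        TotalSpace (EuclideanSpace ℝ (Fin n)) (fun x : X => TangentSpace (𝓡 n) x)))
      (chartAt (EuclideanSpace ℝ (Fin n)) x₀).source := by
    intro i
    set e := trivializationAt (EuclideanSpace ℝ (Fin n))
      (fun x : X => TangentSpace (𝓡 n) x) x₀ with he
    have h1 : ContMDiffOn (𝓡 n) ((𝓡 n).prod 𝓘(ℝ, EuclideanSpace ℝ (Fin n))) ∞
      (fun x : X => e.toOpenPartialHomeomorph.symm (x, EuclideanSpace.single i (1 : ℝ)))
        e.baseSet := by
      refine (e.contMDiffOn_symm (n := ∞) (IB := 𝓡 n)).comp (t := e.target)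
        (contMDiffOn_id.prodMk contMDiffOn_const) ?_
      intro x hx
      simp [e.mem_target, hx]
    have hb : e.baseSet = (chartAt (EuclideanSpace ℝ (Fin n)) x₀).source := by
      simp [he]
    rw [← hb]
    refine h1.congr fun x hx => ?_
    exact (e.mk_symm hx _)
  unfold volumeDensity
  refine Real.continuous_sqrt.comp_continuousOn ?_
  have hc : ∀ i j : Fin n, ContinuousOn
      (fun x => g.inner x (coordVector x₀ x i) (coordVector x₀ x j))
      (chartAt (EuclideanSpace ℝ (Fin n)) x₀).source := by
    intro i j
    have := ContMDiffOn.clm_bundle_apply₂ (E₁ := fun x : X => TangentSpace (𝓡 n) x)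
      (E₂ := fun x : X => TangentSpace (𝓡 n) x) (E₃ := fun _ : X => ℝ) (F₁ := EuclideanSpace ℝ (Fin n)) (F₂ := EuclideanSpace ℝ (Fin n)) (F₃ := ℝ)
      (b := fun x : X => x) (ψ := fun x => g.inner x) 
      (g.contMDiff.contMDiffOn (s := (chartAt (EuclideanSpace ℝ (Fin n)) x₀).source)) (hsec i) (hsec j)
    intro x hx
    have := this x hx
    rw [contMDiffWithinAt_totalSpace] at this
    exact this.2.continuousWithinAt
  simp only [Matrix.det_apply]
  refine continuousOn_finsetSum _ fun σ _ => ?_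
  refine ContinuousOn.const_smul ?_ _
  exact continuousOn_finsetProd _ fun i _ => hc _ _

variable [MeasurableSpace X] [BorelSpace X]

/-- The Riemannian measure `√ det (g (∂ᵢ, ∂ⱼ)) du₁ ⋯ duₙ` on the preferred chart around `x₀`. -/
def chartVolume (g : RiemMetric n X) (x₀ : X) : Measure X :=
  ((volume.restrict (extChartAt (𝓡 n) x₀).target).withDensity fun y =>
    ENNReal.ofReal (volumeDensity g x₀ ((extChartAt (𝓡 n) x₀).symm y))).map
      (extChartAt (𝓡 n) x₀).symm

theorem chartVolume_lt_top [T2Space X] (g : RiemMetric n X) (x₀ : X) {K : Set X} (hK : IsCompact K)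
    (hKs : K ⊆ (chartAt (EuclideanSpace ℝ (Fin n)) x₀).source) : chartVolume g x₀ K < ⊤ := by
  set φ := extChartAt (𝓡 n) x₀ with hφ
  have hsrc : φ.source = (chartAt (EuclideanSpace ℝ (Fin n)) x₀).source := extChartAt_source _ _
  have hopen : IsOpen φ.target := isOpen_extChartAt_target x₀
  have hmeas : AEMeasurable φ.symm ((volume.restrict φ.target).withDensity fun y =>
      ENNReal.ofReal (volumeDensity g x₀ (φ.symm y))) := by
    refine AEMeasurable.mono_ac ?_ (withDensity_absolutelyContinuous _ _)
    exact (continuousOn_extChartAt_symm x₀).aemeasurable hopen.measurableSet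
  have himg : IsCompact (φ '' K) :=
    hK.image_of_continuousOn ((continuousOn_extChartAt x₀).mono (by rw [← hφ, hsrc]; exact hKs))
  obtain ⟨C, hC⟩ := hK.exists_bound_of_continuousOn ((continuousOn_volumeDensity g x₀).mono hKs)
  have hsub : φ.symm ⁻¹' K ∩ φ.target ⊆ φ '' K := fun y hy =>
    ⟨φ.symm y, hy.1, φ.right_inv hy.2⟩
  have hpre : NullMeasurableSet (φ.symm ⁻¹' K) ((volume.restrict φ.target).withDensity fun y =>
      ENNReal.ofReal (volumeDensity g x₀ (φ.symm y))) :=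
    hmeas.nullMeasurable hK.measurableSet
  have hlt : volume (φ '' K) < ⊤ := himg.measure_lt_top
  have key : (volume.restrict φ.target).withDensity (fun y =>
      ENNReal.ofReal (volumeDensity g x₀ (φ.symm y))) (φ.symm ⁻¹' K) ≤
      ENNReal.ofReal C * volume (φ '' K) := by
    set ν := (volume.restrict φ.target).withDensity (fun y =>
      ENNReal.ofReal (volumeDensity g x₀ (φ.symm y))) with hν
    have h0 : ν φ.targetᶜ = 0 := by
      refine withDensity_absolutelyContinuous _ _ ?_
      rw [Measure.restrict_apply hopen.measurableSet.compl]
      simp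
    have h1 : ν (φ '' K) ≤ ENNReal.ofReal C * volume (φ '' K) := by
      rw [hν, withDensity_apply _ himg.measurableSet]
      calc _ ≤ ∫⁻ _ in φ '' K, ENNReal.ofReal C ∂(volume.restrict φ.target) := by
            refine setLIntegral_mono' himg.measurableSet fun y hy => ?_
            obtain ⟨x, hx, rfl⟩ := hy
            rw [φ.left_inv (by rw [hsrc]; exact hKs hx)]
            exact ENNReal.ofReal_le_ofReal ((le_abs_self _).trans (hC x hx))
        _ ≤ _ := by
            rw [setLIntegral_const]
            gcongr
            exact Measure.restrict_le_self
    calc ν (φ.symm ⁻¹' K) ≤ ν (φ '' K ∪ φ.targetᶜ) := by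
          refine measure_mono fun y hy => ?_
          by_cases hy' : y ∈ φ.target
          · exact Or.inl (hsub ⟨hy, hy'⟩)
          · exact Or.inr hy'
      _ ≤ ν (φ '' K) + ν φ.targetᶜ := measure_union_le _ _
      _ ≤ _ := by rw [h0, add_zero]; exact h1
  rw [chartVolume, Measure.map_apply_of_aemeasurable hmeas hK.measurableSet]
  exact key.trans_lt (ENNReal.mul_lt_top ENNReal.ofReal_lt_top hlt)

/-- A smooth partition of unity `(ρ_x)`, with `ρ_x` supported in the preferred chart around `x`. -/
def chartPartition (n : ℕ) (X : Type u) [TopologicalSpace X] [CompactSpace X] [T2Space X]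
    [ChartedSpace (EuclideanSpace ℝ (Fin n)) X] [IsManifold (𝓡 n) ∞ X] :
    SmoothPartitionOfUnity X (𝓡 n) X Set.univ :=
  (SmoothPartitionOfUnity.exists_isSubordinate_chartAt_source (𝓡 n) X).choose

theorem chartPartition_subordinate (n : ℕ) (X : Type u) [TopologicalSpace X] [CompactSpace X]
    [T2Space X] [ChartedSpace (EuclideanSpace ℝ (Fin n)) X] [IsManifold (𝓡 n) ∞ X] :
    (chartPartition n X).IsSubordinate
      fun x => (chartAt (EuclideanSpace ℝ (Fin n)) x).source :=
  (SmoothPartitionOfUnity.exists_isSubordinate_chartAt_source (𝓡 n) X).choose_spec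

variable [CompactSpace X] [T2Space X]

/-- The Riemannian volume measure of `(X, g)`, glued from the local volume measures
`√ det (g (∂ᵢ, ∂ⱼ)) du₁ ⋯ duₙ` with a partition of unity. -/
def volumeMeasure (g : RiemMetric n X) : Measure X :=
  Measure.sum fun x₀ : X =>
    (chartVolume g x₀).withDensity fun x => ENNReal.ofReal (chartPartition n X x₀ x)

instance isFiniteMeasure_volumeMeasure (g : RiemMetric n X) : IsFiniteMeasure (volumeMeasure g) := by
  constructor
  have hfin := (chartPartition n X).locallyFinite.finite_nonempty_of_compact
  rw [volumeMeasure, Measure.sum_apply _ MeasurableSet.univ]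
  have hz : ∀ x₀ : X, x₀ ∉ hfin.toFinset →
      (chartVolume g x₀).withDensity
        (fun x => ENNReal.ofReal (chartPartition n X x₀ x)) Set.univ = 0 := by
    intro x₀ hx₀
    have h0 : ∀ x, chartPartition n X x₀ x = 0 := by
      intro x
      by_contra hx
      exact hx₀ (hfin.mem_toFinset.2 ⟨x, hx⟩)
    simp [h0]
  rw [tsum_eq_sum (s := hfin.toFinset) fun x₀ hx₀ => hz x₀ hx₀]
  refine ENNReal.sum_lt_top.2 fun x₀ _ => ?_
  rw [withDensity_apply _ MeasurableSet.univ, Measure.restrict_univ]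
  have hK : IsCompact (tsupport (chartPartition n X x₀)) := (isClosed_tsupport _).isCompact
  calc _ ≤ ∫⁻ x, (tsupport (chartPartition n X x₀)).indicator 1 x ∂(chartVolume g x₀) := by
        refine lintegral_mono fun x => ?_
        by_cases hx : x ∈ tsupport (chartPartition n X x₀)
        · rw [Set.indicator_of_mem hx]
          simpa using (chartPartition n X).le_one x₀ x
        · rw [Set.indicator_of_notMem hx, image_eq_zero_of_notMem_tsupport hx]
          simp
    _ = chartVolume g x₀ (tsupport (chartPartition n X x₀)) := by
        rw [lintegral_indicator_one hK.measurableSet]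
    _ < ⊤ := chartVolume_lt_top g x₀ hK (chartPartition_subordinate n X x₀)

end Volume

section Bundles

variable (n : ℕ) (X : Type u) [TopologicalSpace X] [ChartedSpace (EuclideanSpace ℝ (Fin n)) X]

/-- A smooth complex Hermitian vector bundle of locally constant finite rank. Each point `x₀` has
an open neighbourhood `dom x₀` over which the bundle is identified with the trivial bundle of
fibre `fiber x₀` (the values of `triv x₀ x` for `x` outside `dom x₀` are irrelevant), and these
trivialisations are smoothly compatible with each other and with the Hermitian metric. -/
structure HermitianBundle where
  fiber : X → Type v
  [normed : ∀ x, NormedAddCommGroup (fiber x)]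
  [inner : ∀ x, InnerProductSpace ℂ (fiber x)]
  [finite : ∀ x, FiniteDimensional ℂ (fiber x)]
  dom : X → Set X
  isOpen_dom : ∀ x₀, IsOpen (dom x₀)
  mem_dom : ∀ x₀, x₀ ∈ dom x₀
  triv : ∀ x₀ x, fiber x₀ →ₗ[ℂ] fiber x
  bijective_triv : ∀ x₀, ∀ x ∈ dom x₀, Function.Bijective (triv x₀ x)
  smooth_transition : ∀ x₀ x₁ (v : fiber x₀), ∃ f : X → fiber x₁,
    ContMDiffOn (𝓡 n) 𝓘(ℝ, fiber x₁) ∞ f (dom x₀ ∩ dom x₁) ∧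
      ∀ x ∈ dom x₀ ∩ dom x₁, triv x₁ x (f x) = triv x₀ x v
  smooth_metric : ∀ x₀ (v w : fiber x₀),
    ContMDiffOn (𝓡 n) 𝓘(ℝ, ℂ) ∞ (fun x => ⟪triv x₀ x v, triv x₀ x w⟫_ℂ) (dom x₀)

/-- A locally trivial smooth bundle of finite-dimensional C⋆-algebras, with the same conventions;
a bijective ⋆-homomorphism between unital algebras is automatically unital. -/
structure AlgebraBundle where
  fiber : X → Type v
  [cstar : ∀ x, CStarAlgebra (fiber x)]
  [finite : ∀ x, FiniteDimensional ℂ (fiber x)]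
  dom : X → Set X
  isOpen_dom : ∀ x₀, IsOpen (dom x₀)
  mem_dom : ∀ x₀, x₀ ∈ dom x₀
  triv : ∀ x₀ x, fiber x₀ →⋆ₙₐ[ℂ] fiber x
  bijective_triv : ∀ x₀, ∀ x ∈ dom x₀, Function.Bijective (triv x₀ x)
  smooth_transition : ∀ x₀ x₁ (v : fiber x₀), ∃ f : X → fiber x₁,
    ContMDiffOn (𝓡 n) 𝓘(ℝ, fiber x₁) ∞ f (dom x₀ ∩ dom x₁) ∧
      ∀ x ∈ dom x₀ ∩ dom x₁, triv x₁ x (f x) = triv x₀ x v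

attribute [instance] HermitianBundle.normed HermitianBundle.inner HermitianBundle.finite
  AlgebraBundle.cstar AlgebraBundle.finite

variable {n X}

instance HermitianBundle.completeSpace_fiber (E : HermitianBundle.{u, v} n X) (x : X) :
    CompleteSpace (E.fiber x) :=
  FiniteDimensional.complete ℂ (E.fiber x)

/-- `s` is a smooth section: in each local trivialisation it is a smooth function. -/
def HermitianBundle.IsSmooth (E : HermitianBundle.{u, v} n X) (s : ∀ x, E.fiber x) : Prop :=
  ∀ x₀, ∃ f : X → E.fiber x₀, ContMDiffOn (𝓡 n) 𝓘(ℝ, E.fiber x₀) ∞ f (E.dom x₀) ∧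
    ∀ x ∈ E.dom x₀, E.triv x₀ x (f x) = s x

/-- `a` is a smooth section: in each local trivialisation it is a smooth function. -/
def AlgebraBundle.IsSmooth (𝒜 : AlgebraBundle.{u, v} n X) (a : ∀ x, 𝒜.fiber x) : Prop :=
  ∀ x₀, ∃ f : X → 𝒜.fiber x₀, ContMDiffOn (𝓡 n) 𝓘(ℝ, 𝒜.fiber x₀) ∞ f (𝒜.dom x₀) ∧
    ∀ x ∈ 𝒜.dom x₀, 𝒜.triv x₀ x (f x) = a x

theorem HermitianBundle.IsSmooth.smul {E : HermitianBundle.{u, v} n X} {s : ∀ x, E.fiber x}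
    (hs : E.IsSmooth s) {f : X → ℂ} (hf : ContMDiff (𝓡 n) 𝓘(ℝ, ℂ) ∞ f) :
    E.IsSmooth fun x => f x • s x := by
  intro x₀
  obtain ⟨h, hh, hh'⟩ := hs x₀
  refine ⟨fun x => f x • h x, ?_, fun x hx => by simp [hh' x hx]⟩
  exact (isBoundedBilinearMap_smul (𝕜 := ℝ) (A := ℂ) (E := E.fiber x₀)).contDiff.contMDiff.comp_contMDiffOn
    (hf.contMDiffOn.prodMk_space hh)

/-- The space `C^∞(X, E)` of smooth sections. -/
def HermitianBundle.Sections (E : HermitianBundle.{u, v} n X) : Submodule ℂ (∀ x, E.fiber x) where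
  carrier := {s | E.IsSmooth s}
  add_mem' := by
    intro s t hs ht x₀
    obtain ⟨f, hf, hf'⟩ := hs x₀
    obtain ⟨h, hh, hh'⟩ := ht x₀
    exact ⟨f + h, hf.add hh, fun x hx => by simp [hf' x hx, hh' x hx]⟩
  zero_mem' := fun x₀ => ⟨0, contMDiffOn_const, fun x _ => by simp⟩
  smul_mem' := fun c s hs => HermitianBundle.IsSmooth.smul hs contMDiff_const

/-- The ⋆-algebra `C^∞(X, 𝒜)` of smooth sections. -/
def AlgebraBundle.Sections (𝒜 : AlgebraBundle.{u, v} n X) :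
    StarSubalgebra ℂ (∀ x, 𝒜.fiber x) where
  carrier := {a | 𝒜.IsSmooth a}
  add_mem' := by
    intro s t hs ht x₀
    obtain ⟨f, hf, hf'⟩ := hs x₀
    obtain ⟨h, hh, hh'⟩ := ht x₀
    exact ⟨f + h, hf.add hh, fun x hx => by simp [hf' x hx, hh' x hx]⟩
  mul_mem' := by
    intro s t hs ht x₀
    obtain ⟨f, hf, hf'⟩ := hs x₀
    obtain ⟨h, hh, hh'⟩ := ht x₀
    refine ⟨fun x => f x * h x, ?_, fun x hx => by simp [hf' x hx, hh' x hx]⟩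
    exact (ContinuousLinearMap.mul ℝ (𝒜.fiber x₀)).isBoundedBilinearMap.contDiff.contMDiff.comp_contMDiffOn
      (hf.prodMk_space hh)
  algebraMap_mem' := by
    intro r x₀
    refine ⟨fun _ => r • 1, contMDiffOn_const, fun x hx => ?_⟩
    have h1 : 𝒜.triv x₀ x 1 = 1 := by
      obtain ⟨e, he⟩ := (𝒜.bijective_triv x₀ x hx).2 1
      rw [← mul_one (𝒜.triv x₀ x 1), ← he, ← map_mul, one_mul]
    rw [map_smul, h1, Pi.algebraMap_apply, Algebra.algebraMap_eq_smul_one]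
  star_mem' := by
    intro s hs x₀
    obtain ⟨f, hf, hf'⟩ := hs x₀
    refine ⟨fun x => star (f x), ?_, fun x hx => by simp [hf' x hx, map_star]⟩
    exact ((starL' ℝ : 𝒜.fiber x₀ ≃L[ℝ] 𝒜.fiber x₀).contDiff.contMDiff).comp_contMDiffOn hf

theorem HermitianBundle.continuous_inner (E : HermitianBundle.{u, v} n X) {s t : ∀ x, E.fiber x}
    (hs : E.IsSmooth s) (ht : E.IsSmooth t) : Continuous fun x => ⟪s x, t x⟫_ℂ := by
  rw [continuous_iff_continuousAt]
  intro x₀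
  obtain ⟨f, hf, hf'⟩ := hs x₀
  obtain ⟨h, hh, hh'⟩ := ht x₀
  have hn : E.dom x₀ ∈ nhds x₀ := (E.isOpen_dom x₀).mem_nhds (E.mem_dom x₀)
  let b := Module.finBasis ℂ (E.fiber x₀)
  have hcoord : ∀ (f : X → E.fiber x₀) (i), ContinuousOn f (E.dom x₀) →
      ContinuousOn (fun x => b.repr (f x) i) (E.dom x₀) := by
    intro f i hf
    exact (LinearMap.continuous_of_finiteDimensional (b.coord i)).comp_continuousOn hf
  have key : ContinuousOn (fun x => ∑ i, ∑ j,
      (starRingEnd ℂ) (b.repr (f x) i) * (b.repr (h x) j) *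
        ⟪E.triv x₀ x (b i), E.triv x₀ x (b j)⟫_ℂ) (E.dom x₀) := by
    refine continuousOn_finsetSum _ fun i _ => continuousOn_finsetSum _ fun j _ => ?_
    refine ContinuousOn.mul (ContinuousOn.mul ?_ (hcoord h j hh.continuousOn))
      (E.smooth_metric x₀ _ _).continuousOn
    exact Complex.continuous_conj.comp_continuousOn (hcoord f i hf.continuousOn)
  refine (key.congr fun x hx => ?_).continuousAt hn
  rw [← hf' x hx, ← hh' x hx]
  conv_lhs => rw [← b.sum_repr (f x), ← b.sum_repr (h x)]
  simp only [map_sum, map_smul, sum_inner, inner_sum, inner_smul_left, inner_smul_right,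
    Finset.mul_sum]
  rw [Finset.sum_comm]
  refine Finset.sum_congr rfl fun i _ => Finset.sum_congr rfl fun j _ => ?_
  ring

theorem AlgebraBundle.continuous_norm (𝒜 : AlgebraBundle.{u, v} n X) {a : ∀ x, 𝒜.fiber x}
    (ha : 𝒜.IsSmooth a) : Continuous fun x => ‖a x‖ := by
  rw [continuous_iff_continuousAt]
  intro x₀
  obtain ⟨f, hf, hf'⟩ := ha x₀
  have hn : 𝒜.dom x₀ ∈ nhds x₀ := (𝒜.isOpen_dom x₀).mem_nhds (𝒜.mem_dom x₀)
  refine (hf.continuousOn.norm.congr fun x hx => ?_).continuousAt hn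
  rw [← hf' x hx]
  exact NonUnitalStarAlgHom.norm_map (𝒜.triv x₀ x) (𝒜.bijective_triv x₀ x hx).1 (f x)

end Bundles

section Clifford

variable {n : ℕ} {X : Type u} [TopologicalSpace X]
  [ChartedSpace (EuclideanSpace ℝ (Fin n)) X] [IsManifold (𝓡 n) ∞ X]

instance finiteDimensional_tangentSpace (x : X) :
    FiniteDimensional ℝ (TangentSpace (𝓡 n) x) :=
  inferInstanceAs (FiniteDimensional ℝ (EuclideanSpace ℝ (Fin n)))

/-- The inner product on `T_x X`, as a bilinear form. -/
def tangentForm (g : RiemMetric n X) (x : X) : LinearMap.BilinForm ℝ (TangentSpace (𝓡 n) x) :=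
  LinearMap.mk₂ ℝ (fun v w => g.inner x v w) (by simp) (by simp) (by simp) (by simp)

theorem tangentForm_nondegenerate (g : RiemMetric n X) (x : X) : (tangentForm g x).Nondegenerate := by
  refine ⟨fun v hv => ?_, fun v hv => ?_⟩ <;>
  · by_contra h
    exact (g.pos x v h).ne' (hv v)

/-- The quadratic form `ξ ↦ -g(ξ, ξ)` on the cotangent space `T*_x X`. -/
def cotangentForm (g : RiemMetric n X) (x : X) :
    QuadraticForm ℝ (Module.Dual ℝ (TangentSpace (𝓡 n) x)) :=
  -((tangentForm g x).toQuadraticMap.comp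
    ((tangentForm g x).toDual (tangentForm_nondegenerate g x)).symm.toLinearMap)

/-- The differential of a real function, as a covector. -/
def differential (f : X → ℝ) (x : X) : Module.Dual ℝ (TangentSpace (𝓡 n) x) :=
  (mfderiv (𝓡 n) 𝓘(ℝ, ℝ) f x : TangentSpace (𝓡 n) x →L[ℝ] ℝ).toLinearMap

/-- A (self-adjoint) Clifford module structure on the Hermitian bundle `E`. As covectors are
linear combinations of differentials, smoothness is tested on these. -/
structure CliffordModule (g : RiemMetric n X) (E : HermitianBundle.{u, w} n X) where
  c : ∀ x, Module.Dual ℝ (TangentSpace (𝓡 n) x) →ₗ[ℝ] (E.fiber x →L[ℂ] E.fiber x)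
  c_sq : ∀ x ξ, c x ξ * c x ξ = algebraMap ℝ (E.fiber x →L[ℂ] E.fiber x) (cotangentForm g x ξ)
  c_adjoint : ∀ x ξ, star (c x ξ) = -c x ξ
  smooth_c : ∀ f : X → ℝ, ContMDiff (𝓡 n) 𝓘(ℝ, ℝ) ∞ f → ∀ s, E.IsSmooth s →
    E.IsSmooth fun x => c x (differential f x) (s x)

/-- The extension of the Clifford action to the Clifford algebra of `T*_x X`. -/
def CliffordModule.cl {g : RiemMetric n X} {E : HermitianBundle.{u, w} n X}
    (M : CliffordModule g E) (x : X) :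
    CliffordAlgebra (cotangentForm g x) →ₐ[ℝ] (E.fiber x →L[ℂ] E.fiber x) :=
  CliffordAlgebra.lift (cotangentForm g x) ⟨M.c x, M.c_sq x⟩

/-- A Clifford `𝒜 ⊗ 𝒜ᵒ`-module: a Clifford module with a faithful ⋆-representation of
`𝒜 ⊗ 𝒜ᵒ` commuting with the Clifford action. -/
structure CliffordBimodule (g : RiemMetric n X) (𝒜 : AlgebraBundle.{u, v} n X)
    (E : HermitianBundle.{u, w} n X) extends CliffordModule g E where
  ρ : ∀ x, (𝒜.fiber x ⊗[ℂ] (𝒜.fiber x)ᵐᵒᵖ) →⋆ₐ[ℂ] (E.fiber x →L[ℂ] E.fiber x)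
  injective_ρ : ∀ x, Function.Injective (ρ x)
  commute : ∀ x ξ t, Commute (c x ξ) (ρ x t)
  smooth_ρ : ∀ a b, 𝒜.IsSmooth a → 𝒜.IsSmooth b → ∀ s, E.IsSmooth s →
    E.IsSmooth fun x => ρ x (a x ⊗ₜ MulOpposite.op (b x)) (s x)

/-- The sign `ε` of `KO`-dimension `k mod 8`. -/
def koε (k : ZMod 8) : ℤ := (![1, 1, -1, -1, -1, -1, 1, 1] : Fin 8 → ℤ) k

/-- The sign `ε'` of `KO`-dimension `k mod 8`. -/
def koε' (k : ZMod 8) : ℤ := (![1, -1, 1, 1, 1, -1, 1, 1] : Fin 8 → ℤ) k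

/-- The sign `ε''` of `KO`-dimension `k mod 8` (set to `1` for `k` odd). -/
def koε'' (k : ZMod 8) : ℤ := (![1, 1, -1, 1, 1, 1, -1, 1] : Fin 8 → ℤ) k

/-- For `e = ±1`, the anti-involution `τ_e` of the Clifford algebra with `τ_e ξ = -e ξ` for each
covector `ξ`. -/
def cliffordτ {V : Type*} [AddCommGroup V] [Module ℝ V] (Q : QuadraticForm ℝ V) (e : ℤ)
    (η : CliffordAlgebra Q) : CliffordAlgebra Q :=
  if e = 1 then CliffordAlgebra.reverse (CliffordAlgebra.involute η) else CliffordAlgebra.reverse η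

variable {g : RiemMetric n X} {𝒜 : AlgebraBundle.{u, v} n X} {E : HermitianBundle.{u, w} n X}

/-- A `ℤ/2`-grading of a Clifford `𝒜 ⊗ 𝒜ᵒ`-module: covectors are odd, `𝒜 ⊗ 𝒜ᵒ` is even. -/
structure Grading (M : CliffordBimodule g 𝒜 E) where
  γ : ∀ x, E.fiber x →L[ℂ] E.fiber x
  smooth_γ : ∀ s, E.IsSmooth s → E.IsSmooth fun x => γ x (s x)
  γ_sq : ∀ x, γ x * γ x = 1
  γ_adjoint : ∀ x, star (γ x) = γ x
  γ_c : ∀ x ξ, γ x * M.c x ξ = -(M.c x ξ * γ x)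
  γ_ρ : ∀ x t, γ x * M.ρ x t = M.ρ x t * γ x

/-- Data making `(E, J)` a real Clifford `𝒜`-bimodule of `KO`-dimension `k mod 8`. In `J_conj` the
complex scalars of the complexified Clifford algebra are absorbed in `a`. -/
structure RealStructure (M : CliffordBimodule g 𝒜 E) (k : ZMod 8) where
  J : ∀ x, E.fiber x ≃ₛₗᵢ[starRingEnd ℂ] E.fiber x
  smooth_J : ∀ s, E.IsSmooth s → E.IsSmooth fun x => J x (s x)
  J_sq : ∀ x e, J x (J x e) = koε k • e
  J_conj : ∀ x (η : CliffordAlgebra (cotangentForm g x)) (a b : 𝒜.fiber x) (e : E.fiber x),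
    J x (M.cl x (star η) (M.ρ x (star a ⊗ₜ MulOpposite.op (star b)) ((J x).symm e))) =
      M.cl x (cliffordτ _ (koε' k) η) (M.ρ x (b ⊗ₜ MulOpposite.op a) e)
  grading : Even k → Grading M
  J_γ : ∀ (h : Even k) x e, J x ((grading h).γ x e) = koε'' k • (grading h).γ x (J x e)

end Clifford

section Operators

variable {n : ℕ} {X : Type u} [TopologicalSpace X]
  [ChartedSpace (EuclideanSpace ℝ (Fin n)) X] [IsManifold (𝓡 n) ∞ X]
  {g : RiemMetric n X} {𝒜 : AlgebraBundle.{u, v} n X} {E : HermitianBundle.{u, w} n X}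

/-- The commutator `[S, T] = S T - T S`. -/
def opCommutator {V : Type*} [AddCommGroup V] [Module ℂ V] (S T : V →ₗ[ℂ] V) : V →ₗ[ℂ] V :=
  S ∘ₗ T - T ∘ₗ S

/-- Multiplication by a smooth real function, as an operator on `C^∞(X, E)`. -/
def HermitianBundle.mulReal (E : HermitianBundle.{u, w} n X) (f : X → ℝ)
    (hf : ContMDiff (𝓡 n) 𝓘(ℝ, ℝ) ∞ f) : E.Sections →ₗ[ℂ] E.Sections where
  toFun s := ⟨fun x => (f x : ℂ) • s.1 x, HermitianBundle.IsSmooth.smul s.2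
    (Complex.ofRealCLM.contDiff.contMDiff.comp hf)⟩
  map_add' s t := by ext x; simp
  map_smul' r s := by ext x; simp [smul_comm (f x : ℂ) r]

/-- The action `s ↦ (a ⊗ 1) s` of `a ∈ C^∞(X, 𝒜)` on `C^∞(X, E)`. -/
def CliffordBimodule.left (M : CliffordBimodule g 𝒜 E) (a : 𝒜.Sections) :
    E.Sections →ₗ[ℂ] E.Sections where
  toFun s := ⟨fun x => M.ρ x (a.1 x ⊗ₜ MulOpposite.op 1) (s.1 x),
    M.smooth_ρ a.1 1 a.2 (one_mem 𝒜.Sections) s.1 s.2⟩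
  map_add' s t := by ext x; simp
  map_smul' r s := by ext x; simp

/-- The action `s ↦ (1 ⊗ bᵒ) s` of `b ∈ C^∞(X, 𝒜)` on `C^∞(X, E)`. -/
def CliffordBimodule.right (M : CliffordBimodule g 𝒜 E) (b : 𝒜.Sections) :
    E.Sections →ₗ[ℂ] E.Sections where
  toFun s := ⟨fun x => M.ρ x (1 ⊗ₜ MulOpposite.op (b.1 x)) (s.1 x),
    M.smooth_ρ 1 b.1 (one_mem 𝒜.Sections) b.2 s.1 s.2⟩
  map_add' s t := by ext x; simp
  map_smul' r s := by ext x; simp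

/-- The grading operator on `C^∞(X, E)`. -/
def Grading.op {M : CliffordBimodule g 𝒜 E} (G : Grading M) : E.Sections →ₗ[ℂ] E.Sections where
  toFun s := ⟨fun x => G.γ x (s.1 x), G.smooth_γ s.1 s.2⟩
  map_add' s t := by ext x; simp
  map_smul' r s := by ext x; simp

theorem RealStructure.smooth_J_symm {M : CliffordBimodule g 𝒜 E} {k : ZMod 8}
    (R : RealStructure M k) (s : ∀ x, E.fiber x) (hs : E.IsSmooth s) :
    E.IsSmooth fun x => (R.J x).symm (s x) := by
  have hk : koε k * koε k = 1 := by
    clear R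
    revert k
    decide
  have h : (fun x => (R.J x).symm (s x)) = (koε k : ℂ) • fun x => R.J x (s x) := by
    funext x
    apply (R.J x).injective
    have h1 : (koε k : ℂ) * koε k = 1 := by exact_mod_cast hk
    rw [LinearIsometryEquiv.apply_symm_apply, Pi.smul_apply, map_smulₛₗ, R.J_sq,
      ← Int.cast_smul_eq_zsmul ℂ, smul_smul]
    simp [h1]
  rw [h]
  exact E.Sections.smul_mem _ (show _ ∈ E.Sections from R.smooth_J s hs)

/-- The conjugate-linear bijection of `C^∞(X, E)` induced by `J`. -/
def RealStructure.op {M : CliffordBimodule g 𝒜 E} {k : ZMod 8} (R : RealStructure M k) :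
    E.Sections ≃ₛₗ[starRingEnd ℂ] E.Sections where
  toFun s := ⟨fun x => R.J x (s.1 x), R.smooth_J s.1 s.2⟩
  invFun s := ⟨fun x => (R.J x).symm (s.1 x), R.smooth_J_symm s.1 s.2⟩
  map_add' s t := by ext x; simp
  map_smul' r s := by ext x; simp [map_smulₛₗ]
  left_inv s := by ext x; simp
  right_inv s := by ext x; simp

variable [MeasurableSpace X] [BorelSpace X] [CompactSpace X] [T2Space X]

/-- A symmetric Dirac-type operator on the Clifford module `E`, acting on `C^∞(X, E)`. The
commutation relation forces `D` to be a first-order differential operator. -/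
structure DiracOperator (M : CliffordModule g E) where
  D : E.Sections →ₗ[ℂ] E.Sections
  commutator : ∀ (f : X → ℝ) (hf : ContMDiff (𝓡 n) 𝓘(ℝ, ℝ) ∞ f) (s : E.Sections) (x : X),
    (opCommutator D (E.mulReal f hf) s).1 x = M.c x (differential f x) (s.1 x)
  symmetric : ∀ s t : E.Sections, ∫ x, ⟪(D s).1 x, t.1 x⟫_ℂ ∂(volumeMeasure g) =
    ∫ x, ⟪s.1 x, (D t).1 x⟫_ℂ ∂(volumeMeasure g)

/-- `C^∞(X, E)` with the inner product `∫ ⟪s x, t x⟫` against the Riemannian volume. -/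
def PreL2 (_g : RiemMetric n X) (E : HermitianBundle.{u, w} n X) : Type (max u w) := E.Sections

instance (g : RiemMetric n X) (E : HermitianBundle.{u, w} n X) : AddCommGroup (PreL2 g E) :=
  inferInstanceAs (AddCommGroup E.Sections)

instance (g : RiemMetric n X) (E : HermitianBundle.{u, w} n X) : Module ℂ (PreL2 g E) :=
  inferInstanceAs (Module ℂ E.Sections)

theorem integrable_inner (g : RiemMetric n X) {s t : ∀ x, E.fiber x} (hs : E.IsSmooth s)
    (ht : E.IsSmooth t) : Integrable (fun x => ⟪s x, t x⟫_ℂ) (volumeMeasure g) :=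
  (E.continuous_inner hs ht).integrable_of_hasCompactSupport
    (HasCompactSupport.of_compactSpace _)

instance preL2Core (g : RiemMetric n X) (E : HermitianBundle.{u, w} n X) :
    PreInnerProductSpace.Core ℂ (PreL2 g E) where
  inner s t := ∫ x, ⟪(show E.Sections from s).1 x, (show E.Sections from t).1 x⟫_ℂ ∂(volumeMeasure g)
  conj_inner_symm s t := by
    rw [← integral_conj]
    simp
  re_inner_nonneg s := by
    have h := integral_re (𝕜 := ℂ) (integrable_inner g (show E.Sections from s).2 (show E.Sections from s).2)
    refine le_of_le_of_eq ?_ h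
    exact integral_nonneg fun x => inner_self_nonneg
  add_left s t r := by
    rw [← integral_add (integrable_inner g (show E.Sections from s).2 (show E.Sections from r).2)
      (integrable_inner g (show E.Sections from t).2 (show E.Sections from r).2)]
    exact integral_congr_ae (ae_of_all _ fun x => inner_add_left _ _ _)
  smul_left s t r := by
    rw [← integral_const_mul]
    exact integral_congr_ae (ae_of_all _ fun x => inner_smul_left _ _ _)

instance (g : RiemMetric n X) (E : HermitianBundle.{u, w} n X) : SeminormedAddCommGroup (PreL2 g E) :=
  InnerProductSpace.Core.toSeminormedAddCommGroup (𝕜 := ℂ)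

instance (g : RiemMetric n X) (E : HermitianBundle.{u, w} n X) : InnerProductSpace ℂ (PreL2 g E) :=
  InnerProductSpace.ofCore (preL2Core g E)

/-- The Hilbert space `L²(X, E)`. -/
abbrev L2 (g : RiemMetric n X) (E : HermitianBundle.{u, w} n X) : Type (max u w) :=
  UniformSpace.Completion (PreL2 g E)

/-- The canonical map `C^∞(X, E) → L²(X, E)`. -/
def toL2 (g : RiemMetric n X) (E : HermitianBundle.{u, w} n X) : E.Sections →ₗ[ℂ] L2 g E :=
  (UniformSpace.Completion.toComplₗᵢ (𝕜 := ℂ) (E := PreL2 g E)).toLinearMap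

theorem denseRange_toL2 (g : RiemMetric n X) (E : HermitianBundle.{u, w} n X) :
    DenseRange (toL2 g E) :=
  UniformSpace.Completion.denseRange_coe (α := PreL2 g E)

theorem norm_toL2_sq (g : RiemMetric n X) (s : E.Sections) :
    ‖toL2 g E s‖ ^ 2 = ∫ x, ‖s.1 x‖ ^ 2 ∂(volumeMeasure g) := by
  have h0 : ‖toL2 g E s‖ = ‖(show PreL2 g E from s)‖ := UniformSpace.Completion.norm_coe _
  rw [h0, ← inner_self_eq_norm_sq (𝕜 := ℂ)]
  have h := integral_re (𝕜 := ℂ) (integrable_inner g s.2 s.2)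
  refine Eq.trans (Eq.symm h) ?_
  exact integral_congr_ae (ae_of_all _ fun x => inner_self_eq_norm_sq _)

theorem CliffordBimodule.exists_bound_left (M : CliffordBimodule g 𝒜 E) (a : 𝒜.Sections) :
    ∃ C, ∀ s, ‖toL2 g E (M.left a s)‖ ≤ C * ‖toL2 g E s‖ := by
  obtain ⟨C, hC⟩ := isCompact_univ.exists_bound_of_continuousOn
    (AlgebraBundle.continuous_norm 𝒜 a.2).continuousOn
  refine ⟨|C|, fun s => ?_⟩
  have hpt : ∀ x, ‖(M.left a s).1 x‖ ^ 2 ≤ |C| ^ 2 * ‖s.1 x‖ ^ 2 := by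
    intro x
    let φ : 𝒜.fiber x →⋆ₙₐ[ℂ] (E.fiber x →L[ℂ] E.fiber x) :=
      { toFun := fun b => M.ρ x (b ⊗ₜ MulOpposite.op 1)
        map_smul' := fun r b => by simp [← TensorProduct.smul_tmul']
        map_zero' := by simp
        map_add' := fun b b' => by simp [TensorProduct.add_tmul]
        map_mul' := fun b b' => by simp [← map_mul]
        map_star' := fun b => by simp [← map_star] }
    have h1 : ‖φ (a.1 x)‖ ≤ |C| :=
      (NonUnitalStarAlgHom.norm_apply_le φ _).trans
        ((by simpa using hC x (Set.mem_univ x) : ‖a.1 x‖ ≤ C).trans (le_abs_self C))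
    have h2 : ‖(M.left a s).1 x‖ ≤ |C| * ‖s.1 x‖ :=
      ((φ (a.1 x)).le_opNorm (s.1 x)).trans (by gcongr)
    rw [← mul_pow]
    gcongr
  have hint : ∀ t : E.Sections, Integrable (fun x => ‖t.1 x‖ ^ 2) (volumeMeasure g) := by
    intro t
    refine (integrable_inner g t.2 t.2).re.congr (ae_of_all _ fun x => ?_)
    exact inner_self_eq_norm_sq _
  have h3 : ‖toL2 g E (M.left a s)‖ ^ 2 ≤ (|C| * ‖toL2 g E s‖) ^ 2 := by
    rw [mul_pow, norm_toL2_sq, norm_toL2_sq, ← integral_const_mul]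
    exact integral_mono (hint _) ((hint s).const_mul _) hpt
  exact le_of_sq_le_sq h3 (by positivity)

/-- The representation of `C^∞(X, 𝒜)` by bounded operators on `L²(X, E)`: the continuous
extension of `s ↦ (a ⊗ 1) s`. -/
def CliffordBimodule.π (M : CliffordBimodule g 𝒜 E) (a : 𝒜.Sections) : L2 g E →L[ℂ] L2 g E :=
  (toL2 g E ∘ₗ M.left a).extendOfNorm (toL2 g E)

theorem CliffordBimodule.π_toL2 (M : CliffordBimodule g 𝒜 E) (a : 𝒜.Sections) (s : E.Sections) :
    M.π a (toL2 g E s) = toL2 g E (M.left a s) :=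
  LinearMap.extendOfNorm_eq (denseRange_toL2 g E) (M.exists_bound_left a) s

/-- The antiunitary operator on `L²(X, E)` induced by `J`. -/
def RealStructure.JL2 {M : CliffordBimodule g 𝒜 E} {k : ZMod 8} (R : RealStructure M k) :
    L2 g E ≃ₛₗᵢ[starRingEnd ℂ] L2 g E :=
  R.op.extendOfIsometry (toL2 g E) (toL2 g E) (denseRange_toL2 g E) (denseRange_toL2 g E) <| by
    intro s
    have h : ‖toL2 g E (R.op s)‖ ^ 2 = ‖toL2 g E s‖ ^ 2 := by
      rw [norm_toL2_sq, norm_toL2_sq]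
      exact integral_congr_ae (ae_of_all _ fun x => by simp [RealStructure.op])
    simpa using h

variable (g) (k : ZMod 8)

/-- A concrete real almost-commutative spectral triple `(C^∞(X, 𝒜), L²(X, E), D, J)` of
`KO`-dimension `k mod 8` over the compact Riemannian manifold `(X, g)`, oriented by `orientation`. -/
structure ConcreteTriple where
  orientation : OrientedAtlas n X
  𝒜 : AlgebraBundle.{u, v} n X
  E : HermitianBundle.{u, w} n X
  bimodule : CliffordBimodule g 𝒜 E
  real : RealStructure bimodule k
  dirac : DiracOperator bimodule.toCliffordModule
  odd : ∀ (h : Even k) (s : E.Sections),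
    dirac.D ((real.grading h).op s) = -(real.grading h).op (dirac.D s)
  dirac_J : ∀ s : E.Sections, dirac.D (real.op s) = koε' k • real.op (dirac.D s)
  order_one : ∀ a b : 𝒜.Sections, 
    opCommutator (opCommutator dirac.D (bimodule.left a)) (bimodule.right b) = 0

variable {g k}

/-- The canonical subalgebra `{a | J a* J* = a}` of `C^∞(X, 𝒜)`, an identity of operators on
`L²(X, E)`. -/
def ConcreteTriple.canonicalSubalgebra (T : ConcreteTriple.{u, v, w} g k) : Set T.𝒜.Sections :=
  {a | ∀ ξ : L2 g T.E,
    T.real.JL2 (T.bimodule.π (star a) (T.real.JL2.symm ξ)) = T.bimodule.π a ξ}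

/-- The set `C^∞(X) 1_𝒜` of scalar sections of `𝒜`. -/
def AlgebraBundle.scalars (𝒜 : AlgebraBundle.{u, v} n X) : Set 𝒜.Sections :=
  {a | ∃ f : X → ℂ, ContMDiff (𝓡 n) 𝓘(ℝ, ℂ) ∞ f ∧ ∀ x, a.1 x = f x • 1}

end Operators
end RealAC
end

/-! Taking the Clifford element and `b` to be `1` in the compatibility of `J` with the bimodule
structure gives `J (a* ⊗ 1) J* = 1 ⊗ aᵒ` on smooth sections. The condition `J a* J* = a` therefore
says that left and right multiplication by `a` agree, first as operators on `L²`. Two facts make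
this the same as agreement on smooth sections: these are dense in `L²`, and they embed injectively
in it (`toL2_injective`). The second fact requires the Riemannian volume to be positive on nonempty
open sets, which is deduced from the positivity of the Gram determinants in charts.

Every vector of a fibre is the value of a global smooth section, so equality of the two operators is
equality of `a ⊗ 1` and `1 ⊗ aᵒ` in each fibre representation. Faithfulness lifts this to `𝒜ₓ ⊗
𝒜ₓᵒ`, where applying a functional `φ` with `φ 1 = 1` to the second factor yields `a = φ(a) 1`. The
same functional, read in a local trivialisation, shows that the scalar depends smoothly on the
point. Conversely, scalars pass through the tensor sign. -/

/-- An element of a unital `ℂ`-algebra acting equally from both sides of `A ⊗ Aᵒ` is a scalar. -/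
theorem exists_eq_smul_one_of_tmul_op_eq {A : Type*} [NormedRing A] [NormedAlgebra ℂ A] {a : A}
    (h : a ⊗ₜ[ℂ] MulOpposite.op (1 : A) = 1 ⊗ₜ[ℂ] MulOpposite.op a) : ∃ z : ℂ, a = z • (1 : A) := by
  by_cases h1 : (1 : A) = 0
  · exact ⟨0, by rw [← one_mul a, h1]; simp⟩
  · obtain ⟨φ, hφ⟩ := SeparatingDual.exists_eq_one (R := ℂ) h1
    -- The slice map `id ⊗ φ` sends `a ⊗ 1` to `a` and `1 ⊗ aᵒ` to `φ a • 1`.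
    have := congrArg ((TensorProduct.rid ℂ A).toLinearMap ∘ₗ TensorProduct.map LinearMap.id
      (φ.toLinearMap ∘ₗ (MulOpposite.opLinearEquiv ℂ).symm.toLinearMap)) h
    exact ⟨φ a, by simpa [hφ] using this⟩

namespace RealAC

/-! ### Positivity of the Riemannian volume on nonempty open sets -/

section Volume

variable {n : ℕ} {X : Type u} [TopologicalSpace X]
  [ChartedSpace (EuclideanSpace ℝ (Fin n)) X] [IsManifold (𝓡 n) ∞ X]

/-- The coordinate vectors form a basis of the tangent space at each point of the chart, so their
Gram matrix is positive definite and its determinant is positive. -/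
theorem volumeDensity_pos (g : RiemMetric n X) {x₀ x : X}
    (hx : x ∈ (chartAt (EuclideanSpace ℝ (Fin n)) x₀).source) : 0 < volumeDensity g x₀ x := by
  set e := trivializationAt (EuclideanSpace ℝ (Fin n))
    (fun x : X => TangentSpace (𝓡 n) x) x₀ with he
  have hb : x ∈ e.baseSet := by simpa [he] using hx
  refine Real.sqrt_pos.2 (Matrix.PosDef.det_pos (Matrix.PosDef.of_dotProduct_mulVec_pos ?_ ?_))
  · ext i j
    simpa using g.symm x _ _
  · intro c hc
    set v : TangentSpace (𝓡 n) x := ∑ i, c i • coordVector x₀ x i with hv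
    have hv0 : v ≠ 0 := by
      intro h0
      apply hc
      have h1 : v = e.symmL ℝ x (WithLp.toLp 2 c) := by
        have h2 : (WithLp.toLp 2 c : EuclideanSpace ℝ (Fin n)) =
            ∑ i, c i • EuclideanSpace.single i (1 : ℝ) := by
          ext j
          simp [Pi.single_apply]
        rw [h2, map_sum]
        refine Finset.sum_congr rfl fun i _ => ?_
        rw [map_smul, e.symmL_apply hb]
        rfl
      -- The trivialisation is invertible on the fibre over `x`, so `v = 0` forces `c = 0`.
      have h3 := e.continuousLinearMapAt_symmL (R := ℝ) hb (WithLp.toLp 2 c)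
      rw [← h1, h0, map_zero] at h3
      funext i
      exact (congrArg (fun y : EuclideanSpace ℝ (Fin n) => y i) h3).symm
    have hpos := g.pos x v hv0
    -- The quadratic form of the Gram matrix at `c` is `g(v, v)`.
    refine hpos.trans_eq ?_
    rw [hv]
    simp only [map_sum, map_smul, sum_apply, smul_apply,
      dotProduct, Matrix.mulVec, Finset.mul_sum, Matrix.of_apply, star_trivial, smul_eq_mul]
    rw [Finset.sum_comm]
    exact Finset.sum_congr rfl fun i _ => Finset.sum_congr rfl fun j _ => by ring

variable [MeasurableSpace X] [BorelSpace X]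

/-- The chart carries `V` to a nonempty open subset of Euclidean space, which has positive Lebesgue
measure, and the density is strictly positive there. -/
theorem chartVolume_pos [T2Space X] (g : RiemMetric n X) (x₀ : X) {V : Set X} (hV : IsOpen V)
    (hVs : V ⊆ (chartAt (EuclideanSpace ℝ (Fin n)) x₀).source) (hne : V.Nonempty) :
    chartVolume g x₀ V ≠ 0 := by
  set φ := extChartAt (𝓡 n) x₀ with hφ
  have hsrc : φ.source = (chartAt (EuclideanSpace ℝ (Fin n)) x₀).source := extChartAt_source _ _
  have hopen : IsOpen φ.target := isOpen_extChartAt_target x₀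
  have hcont : ContinuousOn φ.symm φ.target := continuousOn_extChartAt_symm x₀
  have hmeas : AEMeasurable φ.symm (volume.restrict φ.target) :=
    hcont.aemeasurable hopen.measurableSet
  have hdens : AEMeasurable (fun y => ENNReal.ofReal (volumeDensity g x₀ (φ.symm y)))
      (volume.restrict φ.target) := by
    refine ENNReal.measurable_ofReal.comp_aemeasurable ?_
    refine ContinuousOn.aemeasurable ?_ hopen.measurableSet
    refine (continuousOn_volumeDensity g x₀).comp hcont fun y hy => ?_
    rw [← hsrc]
    exact φ.map_target hy
  have hW : IsOpen (φ.target ∩ φ.symm ⁻¹' V) := hcont.isOpen_inter_preimage hopen hV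
  rw [chartVolume, Measure.map_apply_of_aemeasurable
    (hmeas.mono_ac (withDensity_absolutelyContinuous _ _)) hV.measurableSet]
  intro h0
  have h1 := measure_mono_null (Set.inter_subset_right (s := φ.target)) h0
  -- A set is null for a measure with density exactly when its part where the density is nonzero is
  -- null. The density vanishes nowhere on the image of `V`, so that open image would be Lebesgue
  -- null.
  rw [withDensity_apply_eq_zero' hdens, Measure.restrict_apply' hopen.measurableSet] at h1
  refine (hW.measure_pos volume ?_).ne' (measure_mono_null ?_ h1)
  · obtain ⟨x, hx⟩ := hne
    have hx' : x ∈ φ.source := hsrc ▸ hVs hx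
    exact ⟨φ x, φ.map_source hx', by simpa [φ.left_inv hx'] using hx⟩
  · rintro y ⟨hy, hyV⟩
    exact ⟨⟨by simpa using volumeDensity_pos g (hVs hyV), hy, hyV⟩, hy⟩

variable [CompactSpace X] [T2Space X]

/-- Near a point of `U` some partition function is positive, and the corresponding summand of the
glued measure alone already charges `U`. -/
instance isOpenPosMeasure_volumeMeasure (g : RiemMetric n X) :
    (volumeMeasure g).IsOpenPosMeasure := by
  constructor
  rintro U hU ⟨x, hx⟩ h0
  obtain ⟨i, hi⟩ := (chartPartition n X).exists_pos_of_mem (Set.mem_univ x)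
  have hc : Continuous (chartPartition n X i) := (chartPartition n X i).contMDiff.continuous
  have hV : IsOpen (U ∩ {y | 0 < chartPartition n X i y}) :=
    hU.inter (isOpen_lt continuous_const hc)
  refine chartVolume_pos g i hV (fun y hy => chartPartition_subordinate n X i
    (subset_tsupport _ (ne_of_gt hy.2))) ⟨x, hx, hi⟩ ?_
  have h1 : (chartVolume g i).withDensity
      (fun x => ENNReal.ofReal (chartPartition n X i x)) U = 0 := by
    rw [volumeMeasure, Measure.sum_apply _ hU.measurableSet, ENNReal.tsum_eq_zero] at h0
    exact h0 i
  rw [withDensity_apply_eq_zero' (by fun_prop)] at h1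
  refine measure_mono_null ?_ h1
  rintro y ⟨hy, hy'⟩
  exact ⟨by simpa using hy', hy⟩

end Volume

/-! ### Smooth sections: extension from a point, and smoothness of scalar coefficients -/

section Bundles

variable {n : ℕ} {X : Type u} [TopologicalSpace X] [ChartedSpace (EuclideanSpace ℝ (Fin n)) X]

/-- A bump function supported in the trivialising neighbourhood of `x₀` cuts off a section that is
constant in that trivialisation. This allows identities between operators on global sections to be
tested fibre by fibre. -/
theorem HermitianBundle.exists_isSmooth_eq [T2Space X] [IsManifold (𝓡 n) ∞ X]
    (E : HermitianBundle.{u, w} n X) (x₀ : X) (e : E.fiber x₀) :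
    ∃ s : E.Sections, s.1 x₀ = e := by
  obtain ⟨v, hv⟩ := (E.bijective_triv x₀ x₀ (E.mem_dom x₀)).2 e
  obtain ⟨f, -, hf⟩ := ((SmoothBumpFunction.nhds_basis_tsupport (I := 𝓡 n) x₀).mem_iff).1
    ((E.isOpen_dom x₀).mem_nhds (E.mem_dom x₀))
  refine ⟨⟨fun x => (f x : ℂ) • E.triv x₀ x v, fun x₁ => ?_⟩, by simp [hv]⟩
  obtain ⟨h, hh, hh'⟩ := E.smooth_transition x₀ x₁ v
  refine ⟨fun x => f x • h x, fun x hx => ?_, fun x hx => ?_⟩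
  -- On the support of the bump function the transition function is smooth; off it the product
  -- vanishes locally, so the arbitrary values of `triv` outside `dom x₀` do not matter.
  · by_cases hx₀ : x ∈ tsupport f
    · have hn : E.dom x₀ ∩ E.dom x₁ ∈ nhds x :=
        ((E.isOpen_dom x₀).inter (E.isOpen_dom x₁)).mem_nhds ⟨hf hx₀, hx⟩
      exact (f.contMDiffAt.smul (hh.contMDiffAt hn)).contMDiffWithinAt
    · refine (ContMDiffAt.congr_of_eventuallyEq (contMDiffAt_const (c := 0)) ?_).contMDiffWithinAt
      filter_upwards [notMem_tsupport_iff_eventuallyEq.1 hx₀] with y hy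
      simp [hy]
  · beta_reduce
    by_cases hx₀ : x ∈ tsupport f
    · rw [← hh' x ⟨hf hx₀, hx⟩, ← map_smul, Complex.coe_smul]
    · simp [image_eq_zero_of_notMem_tsupport hx₀]

theorem AlgebraBundle.triv_one (𝒜 : AlgebraBundle.{u, v} n X) {x₀ x : X} (hx : x ∈ 𝒜.dom x₀) :
    𝒜.triv x₀ x 1 = 1 := by
  obtain ⟨e, he⟩ := (𝒜.bijective_triv x₀ x hx).2 1
  rw [← mul_one (𝒜.triv x₀ x 1), ← he, ← map_mul, one_mul]

/-- A functional that is `1` on the unit of the model fibre recovers the coefficient from the local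
expression of `a`, so coefficients chosen point by point vary smoothly. -/
theorem AlgebraBundle.mem_scalars_of_forall_exists (𝒜 : AlgebraBundle.{u, v} n X)
    {a : 𝒜.Sections} (ha : ∀ x, ∃ z : ℂ, a.1 x = z • (1 : 𝒜.fiber x)) : a ∈ 𝒜.scalars := by
  classical
  choose z hz using ha
  -- In a zero fibre the coefficient is undetermined, so it is set to `0`. Being zero is locally
  -- constant along the base, hence this choice does not spoil smoothness.
  refine ⟨fun x => if (1 : 𝒜.fiber x) = 0 then 0 else z x, fun x₀ => ?_, fun x => ?_⟩
  · obtain ⟨h, hh, hh'⟩ := a.2 x₀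
    have hn : 𝒜.dom x₀ ∈ nhds x₀ := (𝒜.isOpen_dom x₀).mem_nhds (𝒜.mem_dom x₀)
    have hone : ∀ x ∈ 𝒜.dom x₀, ((1 : 𝒜.fiber x) = 0 ↔ (1 : 𝒜.fiber x₀) = 0) := fun x hx => by
      rw [← 𝒜.triv_one hx]
      exact map_eq_zero_iff _ (𝒜.bijective_triv x₀ x hx).1
    by_cases h1 : (1 : 𝒜.fiber x₀) = 0
    · refine ContMDiffAt.congr_of_eventuallyEq (contMDiffAt_const (c := (0 : ℂ))) ?_
      filter_upwards [hn] with x hx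
      exact if_pos ((hone x hx).2 h1)
    · obtain ⟨φ, hφ⟩ := SeparatingDual.exists_eq_one (R := ℂ) h1
      refine ContMDiffAt.congr_of_eventuallyEq
        (((φ.restrictScalars ℝ).contDiff.contMDiff.comp_contMDiffOn hh).contMDiffAt hn) ?_
      filter_upwards [hn] with x hx
      rw [if_neg (mt (hone x hx).1 h1)]
      have h2 : h x = z x • 1 := (𝒜.bijective_triv x₀ x hx).1 <| by
        rw [hh' x hx, hz x, map_smul, 𝒜.triv_one hx]
      simp [h2, hφ]
  · by_cases h1 : (1 : 𝒜.fiber x) = 0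
    · rw [h1, smul_zero, ← one_mul (a.1 x), h1, zero_mul]
    · simp only [if_neg h1, hz x]

end Bundles

/-! ### Left and right actions on smooth sections -/

section Operators

variable {n : ℕ} {X : Type u} [TopologicalSpace X]
  [ChartedSpace (EuclideanSpace ℝ (Fin n)) X] [IsManifold (𝓡 n) ∞ X]
  {g : RiemMetric n X} {𝒜 : AlgebraBundle.{u, v} n X} {E : HermitianBundle.{u, w} n X}

theorem CliffordBimodule.left_eq_right_of_mem_scalars (M : CliffordBimodule g 𝒜 E)
    {a : 𝒜.Sections} (ha : a ∈ 𝒜.scalars) (s : E.Sections) : M.left a s = M.right a s := by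
  obtain ⟨f, -, hf⟩ := ha
  ext x
  change M.ρ x (a.1 x ⊗ₜ MulOpposite.op 1) (s.1 x) = M.ρ x (1 ⊗ₜ MulOpposite.op (a.1 x)) (s.1 x)
  rw [hf x, MulOpposite.op_smul, TensorProduct.smul_tmul]

/-- Global sections reach every fibre vector, so the operators of `a ⊗ 1` and `1 ⊗ aᵒ` agree on the
fibre; faithfulness then gives equality in the tensor product. -/
theorem CliffordBimodule.exists_eq_smul_one_of_left_eq_right [T2Space X]
    (M : CliffordBimodule g 𝒜 E) {a : 𝒜.Sections} (h : ∀ s, M.left a s = M.right a s) (x : X) :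
    ∃ z : ℂ, a.1 x = z • (1 : 𝒜.fiber x) := by
  refine exists_eq_smul_one_of_tmul_op_eq (M.injective_ρ x (ContinuousLinearMap.ext fun e => ?_))
  obtain ⟨s, rfl⟩ := E.exists_isSmooth_eq x e
  exact congrArg (fun t : E.Sections => t.1 x) (h s)

theorem cliffordτ_one {V : Type*} [AddCommGroup V] [Module ℝ V] (Q : QuadraticForm ℝ V) (e : ℤ) :
    cliffordτ Q e 1 = 1 := by
  unfold cliffordτ
  split_ifs <;> simp

/-- This is the compatibility of `J` with the bimodule at Clifford element `1` and `b = 1`: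
conjugation by `J` exchanges the two sides of the bimodule. -/
theorem RealStructure.op_left_star {M : CliffordBimodule g 𝒜 E} {k : ZMod 8}
    (R : RealStructure M k) (a : 𝒜.Sections) (s : E.Sections) :
    R.op (M.left (star a) (R.op.symm s)) = M.right a s := by
  ext x
  have h := R.J_conj x 1 (a.1 x) 1 (s.1 x)
  simp only [star_one, map_one, cliffordτ_one] at h
  exact h

/-! ### Passage between smooth sections and `L²` -/

variable [MeasurableSpace X] [BorelSpace X] [CompactSpace X] [T2Space X]

theorem RealStructure.JL2_toL2 {M : CliffordBimodule g 𝒜 E} {k : ZMod 8}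
    (R : RealStructure M k) (s : E.Sections) : R.JL2 (toL2 g E s) = toL2 g E (R.op s) :=
  LinearEquiv.extendOfIsometry_eq _ _ _ _ _ _ _

theorem RealStructure.JL2_symm_toL2 {M : CliffordBimodule g 𝒜 E} {k : ZMod 8}
    (R : RealStructure M k) (s : E.Sections) :
    R.JL2.symm (toL2 g E s) = toL2 g E (R.op.symm s) :=
  LinearEquiv.extendOfIsometry_symm_eq _ _ _ _ _ _ _

theorem RealStructure.JL2_π_star_toL2 {M : CliffordBimodule g 𝒜 E} {k : ZMod 8}
    (R : RealStructure M k) (a : 𝒜.Sections) (s : E.Sections) :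
    R.JL2 (M.π (star a) (R.JL2.symm (toL2 g E s))) = toL2 g E (M.right a s) := by
  rw [R.JL2_symm_toL2, M.π_toL2, R.JL2_toL2, R.op_left_star]

/-- A smooth section is determined by its class in `L²(X, E)`. -/
theorem toL2_injective (g : RiemMetric n X) (E : HermitianBundle.{u, w} n X) :
    Function.Injective (toL2 g E) := by
  rw [injective_iff_map_eq_zero]
  intro s hs
  have h0 := norm_toL2_sq g s
  rw [hs, norm_zero, zero_pow two_ne_zero] at h0
  have hcont : Continuous fun x => ‖s.1 x‖ ^ 2 := by
    have := Complex.continuous_re.comp (E.continuous_inner s.2 s.2)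
    refine this.congr fun x => ?_
    exact inner_self_eq_norm_sq (𝕜 := ℂ) _
  ext x
  by_contra hx
  -- A continuous nonnegative function that is nonzero somewhere has positive integral, because the
  -- volume is positive on nonempty open sets.
  exact (hcont.integral_pos_of_hasCompactSupport_nonneg_nonzero
    (μ := volumeMeasure g) (HasCompactSupport.of_compactSpace _) (fun y => by positivity)
    (x := x) (by simpa using hx)).ne h0

/-- On the image of a smooth section both sides of the defining identity are classes of smooth
sections. Injectivity of `toL2` brings the identity down to sections; density and continuity carry
it back up to all of `L²`. -/
theorem ConcreteTriple.mem_canonicalSubalgebra_iff {k : ZMod 8}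
    (T : ConcreteTriple.{u, v, w} g k) (a : T.𝒜.Sections) :
    a ∈ T.canonicalSubalgebra ↔ ∀ s, T.bimodule.left a s = T.bimodule.right a s := by
  constructor
  · intro ha s
    apply toL2_injective g T.E
    rw [← T.bimodule.π_toL2, ← T.real.JL2_π_star_toL2]
    exact (ha _).symm
  · intro h ξ
    refine (denseRange_toL2 g T.E).induction_on ξ (isClosed_eq ?_ ?_) fun s => ?_
    · exact T.real.JL2.continuous.comp ((T.bimodule.π _).continuous.comp T.real.JL2.symm.continuous)
    · exact (T.bimodule.π a).continuous
    · rw [T.real.JL2_π_star_toL2, T.bimodule.π_toL2, h]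

end Operators
end RealAC

theorem mainTheorem3 {n : ℕ} {X : Type u} [TopologicalSpace X] [CompactSpace X]
    [T2Space X] [ChartedSpace (EuclideanSpace ℝ (Fin n)) X] [IsManifold (𝓡 n) ∞ X]
    [MeasurableSpace X] [BorelSpace X] (g : RealAC.RiemMetric n X)
    (k : ZMod 8) (T : RealAC.ConcreteTriple.{u, v, w} g k) :
    T.canonicalSubalgebra = T.𝒜.scalars := by
  ext a
  rw [T.mem_canonicalSubalgebra_iff]
  exact ⟨fun h => T.𝒜.mem_scalars_of_forall_exists
      (T.bimodule.exists_eq_smul_one_of_left_eq_right h),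
    T.bimodule.left_eq_right_of_mem_scalars⟩
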